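/- Let $\Gamma$ be a cancellation monoid (not necessarily commutative; two-sided cancellation) and let $R=\bigoplus_{\alpha\in\Gamma}R_\alpha$ be a $\Gamma$-graded associative ring with identity, i.e. each $R_\alpha$ is an additive subgroup and $R_\alpha R_\beta\subseteq R_{\alpha\beta}$. A graded left (resp. right) $R$-module is a left (resp. right) $R$-module $M=\bigoplus_{\alpha\in\Gamma}M_\alpha$ with additive subgroups $M_\alpha$ such that $R_\alpha M_\beta\subseteq M_{\alpha\beta}$ (resp. $M_\beta R_\alpha\subseteq M_{\beta\alpha}$). A left or right ideal is homogeneous if it is generated by homogeneous elements. For a left or right $R$-module $M$, let $\operatorname{fd}_R(M)\in\{0,1,2,\dots,\infty\}$ be its usual flat dimension, i.e. the least $n$ for which there is an exact sequence $0\to F_n\to\cdots\to F_0\to M\to0$ of $R$-modules with all $F_i$ flat, and $\infty$ if there is none. Put $$\text{gr-}\ell\text{wD}(R)=\sup\{\operatorname{fd}_R(M)\mid M\text{ a graded left }R\text{-module}\},\qquad \text{gr-rwD}(R)=\sup\{\operatorname{fd}_R(M)\mid M\text{ a graded right }R\text{-module}\}.$$ Then $\text{gr-}\ell\text{wD}(R)=\text{gr-rwD}(R)$,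 and this common value, the graded weak dimension $\text{gr-wD}(R)$, satisfies $$\text{gr-wD}(R)=\sup\{\operatorname{fd}_R(R/I)\mid I\text{ a homogeneous right ideal of }R\}=\sup\{\operatorname{fd}_R(R/J)\mid J\text{ a homogeneous left ideal of }R\}.$$ -/

import Mathlib

universe u v

noncomputable section

namespace GradedWD

/-! ### Tensor products and flatness over a noncommutative ring

A left `R`-module is `Module R N`; a right `R`-module is `Module Rᵐᵒᵖ M`, where
`MulOpposite.op r • m` is the element written `m r` on paper. -/

section Tensor

variable (R : Type u) [Ring R]

/-- The subgroup of `M ⊗_ℤ N` generated by all `(m r) ⊗ n - m ⊗ (r n)`. -/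
def balancedRel (M N : Type u) [AddCommGroup M] [Module Rᵐᵒᵖ M] [AddCommGroup N] [Module R N] :
    Submodule ℤ (TensorProduct ℤ M N) :=
  Submodule.span ℤ
    {x | ∃ (m : M) (r : R) (n : N),
      x = TensorProduct.tmul ℤ (MulOpposite.op r • m) n - TensorProduct.tmul ℤ m (r • n)}

/-- The tensor product `M ⊗_R N` (an abelian group) of a right `R`-module `M` and a left
`R`-module `N`. -/
abbrev RingTensor (M N : Type u) [AddCommGroup M] [Module Rᵐᵒᵖ M] [AddCommGroup N] [Module R N] :
    Type u :=
  TensorProduct ℤ M N ⧸ balancedRel R M N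

/-- The additive map underlying an `R`-linear map of right modules, tensored over `ℤ` with `N`,
respects the relations defining `- ⊗_R N`. -/
theorem balancedRel_le_comap {M M' : Type u} [AddCommGroup M] [Module Rᵐᵒᵖ M]
    [AddCommGroup M'] [Module Rᵐᵒᵖ M'] (N : Type u) [AddCommGroup N] [Module R N]
    (f : M →ₗ[Rᵐᵒᵖ] M') :
    balancedRel R M N ≤
      (balancedRel R M' N).comap (f.toAddMonoidHom.toIntLinearMap.rTensor N) := by
  refine Submodule.span_le.2 ?_
  rintro _ ⟨m, r, n, rfl⟩
  refine Submodule.subset_span ⟨f m, r, n, ?_⟩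
  simp

/-- The map `f ⊗ 1 : M ⊗_R N → M' ⊗_R N` induced by a homomorphism `f : M → M'` of right
`R`-modules. -/
def tensorMap {M M' : Type u} [AddCommGroup M] [Module Rᵐᵒᵖ M]
    [AddCommGroup M'] [Module Rᵐᵒᵖ M'] (N : Type u) [AddCommGroup N] [Module R N]
    (f : M →ₗ[Rᵐᵒᵖ] M') : RingTensor R M N →ₗ[ℤ] RingTensor R M' N :=
  (balancedRel R M N).mapQ (balancedRel R M' N) (f.toAddMonoidHom.toIntLinearMap.rTensor N)
    (balancedRel_le_comap R N f)

/-- A left `R`-module `N` is flat if `- ⊗_R N` preserves injectivity of homomorphisms of right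
`R`-modules. A right `R`-module is flat if it is flat as a left module over `Rᵐᵒᵖ`. -/
def IsFlat (N : Type u) [AddCommGroup N] [Module R N] : Prop :=
  ∀ (M M' : Type u) [AddCommGroup M] [Module Rᵐᵒᵖ M] [AddCommGroup M'] [Module Rᵐᵒᵖ M']
    (f : M →ₗ[Rᵐᵒᵖ] M'), Function.Injective f → Function.Injective (tensorMap R N f)

/-- There is an exact sequence `0 → F_n → ⋯ → F_1 → F_0 → M → 0` of `R`-modules with all `F_i`
flat. (The sequence is continued by `F_i = 0` for `i > n`.) -/
def HasFlatResolution (M : Type u) [AddCommGroup M] [Module R M] (n : ℕ) : Prop :=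
  ∃ (F : ℕ → ModuleCat.{u} R) (d : ∀ i, F (i + 1) →ₗ[R] F i) (e : F 0 →ₗ[R] M),
    (∀ i, IsFlat R (F i)) ∧
    Function.Surjective e ∧
    Function.Exact (d 0) e ∧
    (∀ i, Function.Exact (d (i + 1)) (d i)) ∧
    ∀ i, n < i → Subsingleton (F i)

/-- The flat dimension `fd_R(M)`: the least length of a finite flat resolution of `M`, and `∞` if
there is none. For a right `R`-module `M` it is `flatDim Rᵐᵒᵖ M`. -/
def flatDim (M : Type u) [AddCommGroup M] [Module R M] : ℕ∞ :=
  ⨅ (n : ℕ) (_ : HasFlatResolution R M n), (n : ℕ∞)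

end Tensor

/-! ### Gradings by a cancellation monoid -/

section Graded

variable {Γ : Type v} [CancelMonoid Γ] {R : Type u} [Ring R]

open Classical in
/-- `R = ⨁ R_α` with additive subgroups `R_α` such that `R_α R_β ⊆ R_{αβ}`. -/
structure IsRingGrading (𝒜 : Γ → AddSubgroup R) : Prop where
  isInternal : DirectSum.IsInternal 𝒜
  mul_mem : ∀ (α β : Γ) (a b : R), a ∈ 𝒜 α → b ∈ 𝒜 β → a * b ∈ 𝒜 (α * β)

open Classical in
/-- `M = ⨁ M_α` with additive subgroups `M_α` such that `R_α M_β ⊆ M_{αβ}`, for a left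
`R`-module `M`. -/
structure IsLeftModuleGrading (𝒜 : Γ → AddSubgroup R) {M : Type u} [AddCommGroup M] [Module R M]
    (ℳ : Γ → AddSubgroup M) : Prop where
  isInternal : DirectSum.IsInternal ℳ
  smul_mem : ∀ (α β : Γ) (a : R) (m : M), a ∈ 𝒜 α → m ∈ ℳ β → a • m ∈ ℳ (α * β)

open Classical in
/-- `M = ⨁ M_α` with additive subgroups `M_α` such that `M_β R_α ⊆ M_{βα}`, for a right
`R`-module `M`. -/
structure IsRightModuleGrading (𝒜 : Γ → AddSubgroup R) {M : Type u} [AddCommGroup M]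
    [Module Rᵐᵒᵖ M] (ℳ : Γ → AddSubgroup M) : Prop where
  isInternal : DirectSum.IsInternal ℳ
  smul_mem : ∀ (α β : Γ) (a : R) (m : M), a ∈ 𝒜 α → m ∈ ℳ β →
    MulOpposite.op a • m ∈ ℳ (β * α)

/-- A left ideal is homogeneous if it is generated by homogeneous elements. -/
def IsHomogeneousLeftIdeal (𝒜 : Γ → AddSubgroup R) (J : Submodule R R) : Prop :=
  ∃ S : Set R, (∀ s ∈ S, ∃ α, s ∈ 𝒜 α) ∧ Submodule.span R S = J

/-- A right ideal is homogeneous if it is generated by homogeneous elements. -/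
def IsHomogeneousRightIdeal (𝒜 : Γ → AddSubgroup R) (I : Submodule Rᵐᵒᵖ R) : Prop :=
  ∃ S : Set R, (∀ s ∈ S, ∃ α, s ∈ 𝒜 α) ∧ Submodule.span Rᵐᵒᵖ S = I

/-- The graded left weak dimension: the supremum of `fd_R(M)` over all graded left
`R`-modules `M`. -/
def grLeftWeakDim (𝒜 : Γ → AddSubgroup R) : ℕ∞ :=
  ⨆ (M : Type u) (_ : AddCommGroup M) (_ : Module R M)
    (_ : ∃ ℳ : Γ → AddSubgroup M, IsLeftModuleGrading 𝒜 ℳ), flatDim R M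

/-- The graded right weak dimension: the supremum of `fd_R(M)` over all graded right
`R`-modules `M`. -/
def grRightWeakDim (𝒜 : Γ → AddSubgroup R) : ℕ∞ :=
  ⨆ (M : Type u) (_ : AddCommGroup M) (_ : Module Rᵐᵒᵖ M)
    (_ : ∃ ℳ : Γ → AddSubgroup M, IsRightModuleGrading 𝒜 ℳ), flatDim Rᵐᵒᵖ M

end Graded

end GradedWD

end

/-! Four suprema are compared in a cycle: graded left modules, quotients by homogeneous right
ideals, graded right modules, quotients by homogeneous left ideals, and back. Quotients of `R` by
homogeneous ideals are graded, which gives two of the inequalities. The other two are a single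
criterion, applied to `R` and to `Rᵐᵒᵖ` graded by `Γᵐᵒᵖ`: if `fd(R/I) ≤ n` for every homogeneous
right ideal `I`, then `fd(M) ≤ n` for every graded left `M` (`flatDim_le_of_isRightQuotient`).

A flat resolution of `R/I` of length `n` gives `Tor_{n+1}(R/I, M) = 0`. Kernels of graded free
covers are graded, so passing to syzygies of `M` reduces to `n = 0`
(`hasFlatResolution_of_torVanish`). Let `M = F/K` with `F` graded free. Then `Tor_1(R/I, M) = 0`
means `K ∩ IF = IK`. The coordinates of a homogeneous `k ∈ K` are homogeneous; with `I` the right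
ideal they generate, `k ∈ IK`, and taking components produces a graded map `F → K` fixing `k`. Such
maps combine to fix any finite set of homogeneous elements, so `K` is pure in `F` and `M` is flat.
Cancellation ensures that multiplication by a homogeneous element never merges degrees.

Vanishing of Tor is quantified over all flat presentations, so independence of the resolution is
never needed. Working with `A ≃+* Rᵐᵒᵖ` instead of `Rᵐᵒᵖ` itself lets both sides share one proof. -/

noncomputable section

namespace GradedWD

open TensorProduct

/-! ### The balanced tensor product attached to a map `t : A → R` -/

section BalancedTensor

variable {A R : Type u} [Ring A] [Ring R] (t : A → R)

/-- The subgroup of `N ⊗_ℤ M` generated by all `(a n) ⊗ m - n ⊗ (t(a) m)`. -/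
def bRel (N M : Type u) [AddCommGroup N] [Module A N] [AddCommGroup M] [Module R M] :
    Submodule ℤ (N ⊗[ℤ] M) :=
  Submodule.span ℤ {x | ∃ (n : N) (a : A) (m : M), x = (a • n) ⊗ₜ[ℤ] m - n ⊗ₜ[ℤ] (t a • m)}

/-- The balanced tensor product of the `A`-module `N` and the `R`-module `M`, where `a : A` acts
on `M` through `t a`. -/
abbrev BTensor (N M : Type u) [AddCommGroup N] [Module A N] [AddCommGroup M] [Module R M] :
    Type u :=
  (N ⊗[ℤ] M) ⧸ bRel t N M

section Maps

variable {N N' N'' M M' M'' : Type u}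
  [AddCommGroup N] [Module A N] [AddCommGroup N'] [Module A N'] [AddCommGroup N''] [Module A N'']
  [AddCommGroup M] [Module R M] [AddCommGroup M'] [Module R M'] [AddCommGroup M''] [Module R M'']

/-- `f ⊗ 1` over `ℤ`. -/
abbrev intMapL (f : N →ₗ[A] N') (M : Type u) [AddCommGroup M] : N ⊗[ℤ] M →ₗ[ℤ] N' ⊗[ℤ] M :=
  f.toAddMonoidHom.toIntLinearMap.rTensor M

/-- `1 ⊗ g` over `ℤ`. -/
abbrev intMapR (N : Type u) [AddCommGroup N] (g : M →ₗ[R] M') : N ⊗[ℤ] M →ₗ[ℤ] N ⊗[ℤ] M' :=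
  g.toAddMonoidHom.toIntLinearMap.lTensor N

@[simp] theorem intMapL_tmul (f : N →ₗ[A] N') (n : N) (m : M) :
    intMapL f M (n ⊗ₜ[ℤ] m) = f n ⊗ₜ[ℤ] m := rfl

@[simp] theorem intMapR_tmul (g : M →ₗ[R] M') (n : N) (m : M) :
    intMapR N g (n ⊗ₜ[ℤ] m) = n ⊗ₜ[ℤ] g m := rfl

variable (M) in
theorem bRel_le_comap_left (f : N →ₗ[A] N') :
    bRel t N M ≤ (bRel t N' M).comap (intMapL f M) := by
  refine Submodule.span_le.2 ?_
  rintro _ ⟨n, a, m, rfl⟩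
  exact Submodule.subset_span ⟨f n, a, m, by simp⟩

variable (N) in
theorem bRel_le_comap_right (g : M →ₗ[R] M') :
    bRel t N M ≤ (bRel t N M').comap (intMapR N g) := by
  refine Submodule.span_le.2 ?_
  rintro _ ⟨n, a, m, rfl⟩
  exact Submodule.subset_span ⟨n, a, g m, by simp⟩

variable (M) in
/-- The map `f ⊗ 1` of balanced tensor products. -/
def mapL (f : N →ₗ[A] N') : BTensor t N M →ₗ[ℤ] BTensor t N' M :=
  (bRel t N M).mapQ (bRel t N' M) (intMapL f M) (bRel_le_comap_left t M f)

variable (N) in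
/-- The map `1 ⊗ g` of balanced tensor products. -/
def mapR (g : M →ₗ[R] M') : BTensor t N M →ₗ[ℤ] BTensor t N M' :=
  (bRel t N M).mapQ (bRel t N M') (intMapR N g) (bRel_le_comap_right t N g)

/-- The class of `n ⊗ m`. -/
def btmul (n : N) (m : M) : BTensor t N M := (bRel t N M).mkQ (n ⊗ₜ[ℤ] m)

theorem btmul_smul (n : N) (a : A) (m : M) : btmul t (a • n) m = btmul t n (t a • m) := by
  rw [btmul, btmul, ← sub_eq_zero, ← map_sub, Submodule.mkQ_apply, Submodule.Quotient.mk_eq_zero]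
  exact Submodule.subset_span ⟨n, a, m, rfl⟩

theorem btmul_add_left (n n' : N) (m : M) : btmul t (n + n') m = btmul t n m + btmul t n' m := by
  simp only [btmul, TensorProduct.add_tmul, map_add]

theorem btmul_add_right (n : N) (m m' : M) : btmul t n (m + m') = btmul t n m + btmul t n m' := by
  simp only [btmul, TensorProduct.tmul_add, map_add]

theorem btmul_zero_left (m : M) : btmul t (0 : N) m = 0 := by
  simp only [btmul, TensorProduct.zero_tmul, map_zero]

theorem btmul_zero_right (n : N) : btmul t n (0 : M) = 0 := by
  simp only [btmul, TensorProduct.tmul_zero, map_zero]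

@[simp] theorem mapL_btmul (f : N →ₗ[A] N') (n : N) (m : M) :
    mapL t M f (btmul t n m) = btmul t (f n) m := rfl

@[simp] theorem mapR_btmul (g : M →ₗ[R] M') (n : N) (m : M) :
    mapR t N g (btmul t n m) = btmul t n (g m) := rfl

theorem BTensor.induction {p : BTensor t N M → Prop} (tmul : ∀ n m, p (btmul t n m))
    (zero : p 0) (add : ∀ x y, p x → p y → p (x + y)) (x : BTensor t N M) : p x := by
  obtain ⟨x, rfl⟩ := (bRel t N M).mkQ_surjective x
  induction x with
  | zero => simpa using zero
  | tmul n m => exact tmul n m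
  | add x y hx hy => simpa using add _ _ hx hy

theorem mapL_mapR_comm (f : N →ₗ[A] N') (g : M →ₗ[R] M') (x : BTensor t N M) :
    mapL t M' f (mapR t N g x) = mapR t N' g (mapL t M f x) := by
  induction x using BTensor.induction with
  | tmul n m => simp
  | zero => simp
  | add x y hx hy => simp only [map_add, hx, hy]

/-- A descent criterion for exactness of a map induced on quotients. -/
theorem exact_mapQ {X Y Z : Type u} [AddCommGroup X] [AddCommGroup Y] [AddCommGroup Z]
    {p : Submodule ℤ X} {q : Submodule ℤ Y} {r : Submodule ℤ Z}
    (f : X →ₗ[ℤ] Y) (g : Y →ₗ[ℤ] Z) (hf : p ≤ q.comap f) (hg : q ≤ r.comap g)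
    (hr : r ≤ q.map g) (hfg : Function.Exact f g) :
    Function.Exact (p.mapQ q f hf) (q.mapQ r g hg) := by
  intro y
  obtain ⟨y, rfl⟩ := q.mkQ_surjective y
  constructor
  · intro h
    simp only [Submodule.mkQ_apply, Submodule.mapQ_apply, Submodule.Quotient.mk_eq_zero] at h
    obtain ⟨b, hb, hby⟩ := hr h
    obtain ⟨x, hx⟩ := (hfg (y - b)).1 (by rw [map_sub, hby, sub_self])
    refine ⟨p.mkQ x, ?_⟩
    simp only [Submodule.mkQ_apply, Submodule.mapQ_apply, hx]
    rw [Submodule.Quotient.eq]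
    simpa using hb
  · rintro ⟨x, hx⟩
    obtain ⟨x, rfl⟩ := p.mkQ_surjective x
    rw [← hx]
    simp [Submodule.mapQ_apply, hfg.apply_apply_eq_zero]

-- Right exactness over `ℤ` descends to the quotients because `g` is onto: each generating relation
-- of the last term lifts to a relation of the middle term.
variable (M) in
theorem mapL_exact {f : N →ₗ[A] N'} {g : N' →ₗ[A] N''} (hfg : Function.Exact f g)
    (hg : Function.Surjective g) : Function.Exact (mapL t M f) (mapL t M g) := by
  refine exact_mapQ _ _ _ _ (Submodule.span_le.2 ?_) (rTensor_exact M hfg hg)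
  rintro _ ⟨n, a, m, rfl⟩
  obtain ⟨n, rfl⟩ := hg n
  exact ⟨_, Submodule.subset_span ⟨n, a, m, rfl⟩, by simp⟩

variable (N) in
theorem mapR_exact {f : M →ₗ[R] M'} {g : M' →ₗ[R] M''} (hfg : Function.Exact f g)
    (hg : Function.Surjective g) : Function.Exact (mapR t N f) (mapR t N g) := by
  refine exact_mapQ _ _ _ _ (Submodule.span_le.2 ?_) (lTensor_exact N hfg hg)
  rintro _ ⟨n, a, m, rfl⟩
  obtain ⟨m, rfl⟩ := hg m
  exact ⟨_, Submodule.subset_span ⟨n, a, m, rfl⟩, by simp⟩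

variable (M) in
theorem mapL_surjective {f : N →ₗ[A] N'} (hf : Function.Surjective f) :
    Function.Surjective (mapL t M f) := by
  intro x
  induction x using BTensor.induction with
  | tmul n m =>
    obtain ⟨n, rfl⟩ := hf n
    exact ⟨btmul t n m, rfl⟩
  | zero => exact ⟨0, map_zero _⟩
  | add x y hx hy =>
    obtain ⟨x, rfl⟩ := hx
    obtain ⟨y, rfl⟩ := hy
    exact ⟨x + y, map_add _ _ _⟩

variable (N) in
theorem mapR_surjective {g : M →ₗ[R] M'} (hg : Function.Surjective g) :
    Function.Surjective (mapR t N g) := by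
  intro x
  induction x using BTensor.induction with
  | tmul n m =>
    obtain ⟨m, rfl⟩ := hg m
    exact ⟨btmul t n m, rfl⟩
  | zero => exact ⟨0, map_zero _⟩
  | add x y hx hy =>
    obtain ⟨x, rfl⟩ := hx
    obtain ⟨y, rfl⟩ := hy
    exact ⟨x + y, map_add _ _ _⟩

theorem mapQ_injective_iff {X Y : Type u} [AddCommGroup X] [AddCommGroup Y]
    {p : Submodule ℤ X} {q : Submodule ℤ Y} (f : X →ₗ[ℤ] Y) (hf : p ≤ q.comap f) :
    Function.Injective (p.mapQ q f hf) ↔ ∀ x, f x ∈ q → x ∈ p := by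
  rw [injective_iff_map_eq_zero]
  constructor
  · intro h x hx
    rw [← Submodule.Quotient.mk_eq_zero]
    exact h _ (by rwa [Submodule.mapQ_apply, Submodule.Quotient.mk_eq_zero])
  · intro h x hx
    obtain ⟨x, rfl⟩ := p.mkQ_surjective x
    rw [Submodule.mkQ_apply, Submodule.mapQ_apply, Submodule.Quotient.mk_eq_zero] at hx
    rw [Submodule.mkQ_apply, Submodule.Quotient.mk_eq_zero]
    exact h x hx

end Maps

/-- A diagram chase in a commutative diagram with three columns `A`, `Q`, `M` and three rows
`L`, `F`, `N`, whose rows and columns are right exact. -/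
theorem injective_of_chase {LA LQ LM FA FQ FM NA NQ : Type u}
    [AddCommGroup LA] [AddCommGroup LQ] [AddCommGroup LM] [AddCommGroup FA] [AddCommGroup FQ]
    [AddCommGroup FM] [AddCommGroup NA] [AddCommGroup NQ]
    (lq : LA →ₗ[ℤ] LQ) (lm : LQ →ₗ[ℤ] LM) (fq : FA →ₗ[ℤ] FQ) (fm : FQ →ₗ[ℤ] FM)
    (nq : NA →ₗ[ℤ] NQ) (vA : LA →ₗ[ℤ] FA) (wA : FA →ₗ[ℤ] NA) (vQ : LQ →ₗ[ℤ] FQ)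
    (wQ : FQ →ₗ[ℤ] NQ) (vM : LM →ₗ[ℤ] FM)
    (h₁ : ∀ x, vQ (lq x) = fq (vA x)) (h₂ : ∀ x, vM (lm x) = fm (vQ x))
    (h₃ : ∀ x, wQ (fq x) = nq (wA x))
    (hl : Function.Exact lq lm) (hlm : Function.Surjective lm) (hf : Function.Exact fq fm)
    (hA : Function.Exact vA wA) (hQ : Function.Exact vQ wQ)
    (hn : Function.Injective nq) (hv : Function.Injective vQ) : Function.Injective vM := by
  rw [injective_iff_map_eq_zero]
  intro x hx
  obtain ⟨x, rfl⟩ := hlm x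
  rw [h₂] at hx
  -- `vQ x` dies in `FM`, so it comes from some `y` in `FA`. Injectivity of `nq` moves `y` back to
  -- `LA`, and injectivity of `vQ` then puts `x` in the image of `lq`.
  obtain ⟨y, hy⟩ := (hf _).1 hx
  have h0 : wA y = 0 := hn (by rw [← h₃, hy, hQ.apply_apply_eq_zero, map_zero])
  obtain ⟨z, rfl⟩ := (hA _).1 h0
  rw [← h₁] at hy
  rw [← hv hy, hl.apply_apply_eq_zero]

/-- `- ⊗ M` preserves injectivity of homomorphisms of `A`-modules. -/
def BFlat (M : Type u) [AddCommGroup M] [Module R M] : Prop :=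
  ∀ (N N' : Type u) [AddCommGroup N] [Module A N] [AddCommGroup N'] [Module A N']
    (f : N →ₗ[A] N'), Function.Injective f → Function.Injective (mapL t M f)

/-- `N ⊗ -` preserves injectivity of homomorphisms of `R`-modules. -/
def BCoflat (N : Type u) [AddCommGroup N] [Module A N] : Prop :=
  ∀ (M M' : Type u) [AddCommGroup M] [Module R M] [AddCommGroup M'] [Module R M']
    (g : M →ₗ[R] M'), Function.Injective g → Function.Injective (mapR t N g)

end BalancedTensor

/-! ### Comparison of the two notions of flatness -/

section Comparison

variable {A R : Type u} [Ring A] [Ring R] (t : A ≃+* Rᵐᵒᵖ)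

/-- The anti-isomorphism `A → R` underlying an isomorphism `A ≃ Rᵐᵒᵖ`. -/
def antiMap (a : A) : R := (t a).unop

theorem antiMap_symm (r : R) : antiMap t (t.symm (MulOpposite.op r)) = r := by simp [antiMap]

/-- Restriction along `t` turns right `R`-modules into `A`-modules, and bijectivity of `t` makes the
two families of balancing relations coincide. -/
theorem BFlat.isFlat {M : Type u} [AddCommGroup M] [Module R M] (h : BFlat (antiMap t) M) :
    IsFlat R M := by
  intro N N' _ _ _ _ f hf
  let _ : Module A N := Module.compHom N t.toRingHom
  let _ : Module A N' := Module.compHom N' t.toRingHom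
  let f' : N →ₗ[A] N' := { f with map_smul' := fun a n => f.map_smul (t a) n }
  have key := (mapQ_injective_iff _ (bRel_le_comap_left (antiMap t) M f')).1 (h N N' f' hf)
  have hrel : ∀ (X : Type u) [AddCommGroup X] [Module Rᵐᵒᵖ X],
      let _ : Module A X := Module.compHom X t.toRingHom
      bRel (antiMap t) X M = balancedRel R X M := by
    intro X _ _
    refine congrArg _ (Set.ext fun x => ⟨?_, ?_⟩)
    · rintro ⟨n, a, m, rfl⟩
      exact ⟨n, (t a).unop, m, rfl⟩
    · rintro ⟨n, r, m, rfl⟩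
      refine ⟨n, t.symm (MulOpposite.op r), m, ?_⟩
      rw [antiMap_symm]
      congr 2
      change _ = t (t.symm (MulOpposite.op r)) • n
      rw [RingEquiv.apply_symm_apply]
  refine (mapQ_injective_iff _ (balancedRel_le_comap R M f)).2 fun x hx => ?_
  rw [← hrel N] 
  exact key x (by rw [hrel N']; exact hx)

/-- `IsFlat` puts `N` in the right-hand factor. Swapping the factors sends each balancing relation
to the negative of one, once `R`-modules are read as right `A`-modules. -/
theorem IsFlat.bCoflat {N : Type u} [AddCommGroup N] [Module A N] (h : IsFlat A N) :
    BCoflat (antiMap t) N := by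
  intro M M' _ _ _ _ g hg
  let s : Aᵐᵒᵖ →+* R := (RingEquiv.opOp R).symm.toRingHom.comp (RingHom.op t.toRingHom)
  let _ : Module Aᵐᵒᵖ M := Module.compHom M s
  let _ : Module Aᵐᵒᵖ M' := Module.compHom M' s
  let g' : M →ₗ[Aᵐᵒᵖ] M' := { g with map_smul' := fun a n => g.map_smul (s a) n }
  have key := (mapQ_injective_iff _ (balancedRel_le_comap A N g')).1 (h M M' g' hg)
  have hrel : ∀ (X : Type u) [AddCommGroup X] [Module R X],
      let _ : Module Aᵐᵒᵖ X := Module.compHom X s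
      ∀ x : N ⊗[ℤ] X, x ∈ bRel (antiMap t) N X ↔
        TensorProduct.comm ℤ N X x ∈ balancedRel A X N := by
    intro X _ _ _ x
    constructor
    · intro hx
      refine (Submodule.span_le (p := (balancedRel A X N).comap
        (TensorProduct.comm ℤ N X).toLinearMap)).2 ?_ hx
      rintro _ ⟨n, a, m, rfl⟩
      rw [← neg_sub, SetLike.mem_coe, neg_mem_iff]
      exact Submodule.subset_span ⟨m, a, n, by simp; rfl⟩
    · intro hx
      have := (Submodule.span_le (p := (bRel (antiMap t) N X).comap
        (TensorProduct.comm ℤ N X).symm.toLinearMap)).2 ?_ hx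
      · have h' : (TensorProduct.comm ℤ N X).symm (TensorProduct.comm ℤ N X x) ∈
            bRel (antiMap t) N X := this
        rwa [LinearEquiv.symm_apply_apply] at h'
      rintro _ ⟨m, a, n, rfl⟩
      rw [← neg_sub, SetLike.mem_coe, neg_mem_iff]
      exact Submodule.subset_span ⟨n, a, m, by simp; rfl⟩
  refine (mapQ_injective_iff _ (bRel_le_comap_right (antiMap t) N g)).2 fun x hx => ?_
  rw [hrel] at hx ⊢
  refine key _ ?_
  have hcomm : g'.toAddMonoidHom.toIntLinearMap.rTensor N ∘ₗ
      (TensorProduct.comm ℤ N M).toLinearMap =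
      (TensorProduct.comm ℤ N M').toLinearMap ∘ₗ intMapR N g :=
    TensorProduct.ext' fun n m => rfl
  exact (LinearMap.congr_fun hcomm x).symm ▸ hx

end Comparison

open TensorProduct

/-! ### Free modules and pure presentations -/

section Resolutions

variable {A R : Type u} [Ring A] [Ring R]

/-- Free modules are flat. -/
theorem bFlat_finsupp (t : A ≃+* Rᵐᵒᵖ) (ι : Type u) : BFlat (antiMap t) (ι →₀ R) := by
  intro N N' _ _ _ _ f hf
  -- The inverse `w` of `antiMap t` reverses products, so `x ⊗ c ↦ (w (c i) • x)_i` is balanced.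
  -- This map `Φ` is natural and has the left inverse `Ψ`, which suffices to reduce injectivity to
  -- coordinates.
  let w : R → A := fun r => t.symm (MulOpposite.op r)
  have hw : ∀ r, antiMap t (w r) = r := antiMap_symm t
  have hwt : ∀ a, w (antiMap t a) = a := fun a => by simp [w, antiMap]
  have hwadd : ∀ r s, w (r + s) = w r + w s := fun r s => by simp [w]
  have hwmul : ∀ r s, w (r * s) = w s * w r := fun r s => by simp [w]
  have hw0 : w 0 = 0 := by simp [w]
  let φ : ∀ (X : Type u) [AddCommGroup X] [Module A X], X →+ (ι →₀ R) →+ (ι →₀ X) := fun X _ _ =>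
    AddMonoidHom.mk' (fun x => AddMonoidHom.mk' (fun c => c.mapRange (fun r => w r • x)
      (by rw [hw0, zero_smul])) (fun c c' => by ext; simp [hwadd, add_smul]))
      (fun x x' => by ext; simp [smul_add])
  have hφ : ∀ (X : Type u) [AddCommGroup X] [Module A X] (x : X) (c : ι →₀ R) (i : ι),
      φ X x c i = w (c i) • x := fun X _ _ x c i => rfl
  let Φ₀ : ∀ (X : Type u) [AddCommGroup X] [Module A X], X ⊗[ℤ] (ι →₀ R) →ₗ[ℤ] (ι →₀ X) :=
    fun X _ _ => (TensorProduct.liftAddHom (φ X) (fun r x c => by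
      rw [map_zsmul, map_zsmul]; rfl)).toIntLinearMap
  let Φ : ∀ (X : Type u) [AddCommGroup X] [Module A X],
      BTensor (antiMap t) X (ι →₀ R) →ₗ[ℤ] (ι →₀ X) := fun X _ _ =>
    (bRel (antiMap t) X (ι →₀ R)).liftQ (Φ₀ X) (by
      refine Submodule.span_le.2 ?_
      rintro _ ⟨n, a, c, rfl⟩
      rw [SetLike.mem_coe, LinearMap.mem_ker, map_sub, sub_eq_zero]
      change φ X (a • n) c = φ X n (antiMap t a • c)
      ext i
      rw [hφ, hφ, Finsupp.smul_apply, smul_eq_mul, hwmul, hwt, smul_smul])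
  have hΦ : ∀ (X : Type u) [AddCommGroup X] [Module A X] (x : X) (c : ι →₀ R),
      Φ X (btmul (antiMap t) x c) = φ X x c := fun X _ _ x c => rfl
  let Ψ : ∀ (X : Type u) [AddCommGroup X] [Module A X],
      (ι →₀ X) →+ BTensor (antiMap t) X (ι →₀ R) := fun X _ _ =>
    Finsupp.liftAddHom fun i => AddMonoidHom.mk' (fun x => btmul _ x (Finsupp.single i 1))
      (fun x x' => btmul_add_left _ _ _ _)
  have hΨΦ : ∀ (X : Type u) [AddCommGroup X] [Module A X] (z : BTensor (antiMap t) X (ι →₀ R)),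
      Ψ X (Φ X z) = z := by
    intro X _ _ z
    induction z using BTensor.induction with
    | zero => simp
    | add x y hx hy => rw [map_add, map_add, hx, hy]
    | tmul x c =>
      rw [hΦ]
      induction c using Finsupp.induction_linear with
      | zero => simp [btmul_zero_right]
      | add c c' hc hc' => rw [map_add, map_add, hc, hc', btmul_add_right]
      | single i r =>
        have : φ X x (Finsupp.single i r) = Finsupp.single i (w r • x) := by
          ext j
          rw [hφ]
          by_cases hij : i = j
          · subst hij; simp
          · simp [Finsupp.single_eq_of_ne' hij, hw0]
        rw [this]
        simp only [Ψ, Finsupp.liftAddHom_apply_single, AddMonoidHom.mk'_apply]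
        rw [btmul_smul, hw, Finsupp.smul_single, smul_eq_mul, mul_one]
  have hnat : ∀ z, Φ N' (mapL _ _ f z) = (Φ N z).mapRange f (map_zero f) := by
    intro z
    induction z using BTensor.induction with
    | zero => simp
    | add x y hx hy => rw [map_add, map_add, map_add, hx, hy, Finsupp.mapRange_add (map_add f)]
    | tmul x c =>
      rw [mapL_btmul, hΦ, hΦ]
      ext i
      rw [hφ, Finsupp.mapRange_apply, hφ, map_smul]
  intro z z' hzz
  have h1 : Φ N z = Φ N z' := by
    apply Finsupp.mapRange_injective f (map_zero f) hf
    rw [← hnat, ← hnat, hzz]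
  rw [← hΨΦ N z, ← hΨΦ N z', h1]

/-- A module with a pure flat presentation is flat. -/
theorem BFlat.of_pure (t : A → R) {K P M : Type u} [AddCommGroup K] [Module R K]
    [AddCommGroup P] [Module R P] [AddCommGroup M] [Module R M] (i : K →ₗ[R] P) (p : P →ₗ[R] M)
    (hP : BFlat t P) (hip : Function.Exact i p) (hp : Function.Surjective p)
    (h : ∀ (N : Type u) [AddCommGroup N] [Module A N], Function.Injective (mapR t N i)) :
    BFlat t M := by
  intro L F _ _ _ _ f hf
  -- Purity of `K` in `P` is used only after tensoring with the cokernel of `f`.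
  have hfq : Function.Exact f f.range.mkQ := LinearMap.exact_map_mkQ_range f
  have hq := f.range.mkQ_surjective
  exact injective_of_chase (mapR t L i) (mapR t L p) (mapR t F i) (mapR t F p)
    (mapR t _ i) (mapL t K f) (mapL t K f.range.mkQ) (mapL t P f) (mapL t P f.range.mkQ)
    (mapL t M f) (fun x => mapL_mapR_comm t _ _ x) (fun x => mapL_mapR_comm t _ _ x)
    (fun x => mapL_mapR_comm t _ _ x) (mapR_exact t L hip hp) (mapR_surjective t L hp)
    (mapR_exact t F hip hp) (mapL_exact t K hfq hq) (mapL_exact t P hfq hq) (h _) (hP _ _ f hf)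

/-! ### Vanishing of Tor and dimension shifting -/

/-- The vanishing of `Tor_{n+1}(N, M)`, computed by flat presentations of `M`. -/
def TorVanish (t : A → R) (N : Type u) [AddCommGroup N] [Module A N] :
    ℕ → ∀ (M : Type u) [AddCommGroup M] [Module R M], Prop
  | 0, M, _, _ => ∀ (K P : Type u) [AddCommGroup K] [Module R K] [AddCommGroup P] [Module R P]
      (i : K →ₗ[R] P) (p : P →ₗ[R] M), BFlat t P → Function.Injective i → Function.Exact i p →
      Function.Surjective p → Function.Injective (mapR t N i)
  | n + 1, M, _, _ => ∀ (K P : Type u) [AddCommGroup K] [Module R K] [AddCommGroup P] [Module R P]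
      (i : K →ₗ[R] P) (p : P →ₗ[R] M), BFlat t P → Function.Injective i → Function.Exact i p →
      Function.Surjective p → TorVanish t N n K

/-- Dimension shifting in the first variable. -/
theorem TorVanish.succ (t : A → R) {N' F N : Type u} [AddCommGroup N'] [Module A N']
    [AddCommGroup F] [Module A F] [AddCommGroup N] [Module A N] (j : N' →ₗ[A] F) (q : F →ₗ[A] N)
    (hF : BCoflat t F) (hj : Function.Injective j) (hjq : Function.Exact j q)
    (hq : Function.Surjective q) (n : ℕ) :
    ∀ (M : Type u) [AddCommGroup M] [Module R M], TorVanish t N' n M → TorVanish t N (n + 1) M := by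
  induction n with
  | zero =>
    intro M _ _ h K P _ _ _ _ i p hP hi hip hp K₂ P₂ _ _ _ _ i₂ p₂ hP₂ hi₂ hip₂ hp₂
    -- The composite `N' ⊗ K → N' ⊗ P → F ⊗ P` is injective and factors through `N' ⊗ K → F ⊗ K`.
    have h1 : Function.Injective (mapL t K j) := by
      have h2 : Function.Injective (mapL t P j ∘ mapR t N' i) :=
        (hP _ _ j hj).comp (h K P i p hP hi hip hp)
      have h3 : mapL t P j ∘ mapR t N' i = mapR t F i ∘ mapL t K j :=
        funext fun x => mapL_mapR_comm t j i x
      rw [h3] at h2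
      exact h2.of_comp
    exact injective_of_chase (mapL t K₂ j) (mapL t K₂ q) (mapL t P₂ j) (mapL t P₂ q)
      (mapL t K j) (mapR t N' i₂) (mapR t N' p₂) (mapR t F i₂) (mapR t F p₂) (mapR t N i₂)
      (fun x => (mapL_mapR_comm t _ _ x).symm) (fun x => (mapL_mapR_comm t _ _ x).symm)
      (fun x => (mapL_mapR_comm t _ _ x).symm) (mapL_exact t K₂ hjq hq) (mapL_surjective t K₂ hq)
      (mapL_exact t P₂ hjq hq) (mapR_exact t N' hip₂ hp₂) (mapR_exact t F hip₂ hp₂) h1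
      (hF _ _ i₂ hi₂)
  | succ n ih =>
    intro M _ _ h K P _ _ _ _ i p hP hi hip hp
    exact ih K (h K P i p hP hi hip hp)

/-- The kernel of `F 0 → N` has a resolution shorter by one, and `TorVanish.succ` recovers the lost
index. In length zero `e` is bijective. -/
theorem HasFlatResolution.torVanish (t : A ≃+* Rᵐᵒᵖ) (n : ℕ) :
    ∀ (N : Type u) [AddCommGroup N] [Module A N], HasFlatResolution A N n →
      ∀ (M : Type u) [AddCommGroup M] [Module R M], TorVanish (antiMap t) N n M := by
  induction n with
  | zero =>
    rintro N _ _ ⟨F, d, e, hF, he, hde, -, h0⟩ M _ _ K P _ _ _ _ i p hP hi hip hp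
    have := h0 1 one_pos
    have hinj : Function.Injective e := by
      rw [injective_iff_map_eq_zero]
      intro x hx
      obtain ⟨y, rfl⟩ := (hde x).1 hx
      rw [Subsingleton.elim y 0, map_zero]
    have hsurj := mapL_surjective (antiMap t) K he
    have hcomp : Function.Injective (mapL (antiMap t) P e ∘ mapR (antiMap t) (F 0) i) :=
      (hP _ _ e hinj).comp ((hF 0).bCoflat t _ _ i hi)
    intro x y hxy
    obtain ⟨x, rfl⟩ := hsurj x
    obtain ⟨y, rfl⟩ := hsurj y
    rw [← mapL_mapR_comm, ← mapL_mapR_comm] at hxy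
    rw [hcomp hxy]
  | succ n ih =>
    rintro N _ _ ⟨F, d, e, hF, he, hde, hd, h0⟩ M _ _
    have hmem : ∀ x, d 0 x ∈ LinearMap.ker e := fun x => hde.apply_apply_eq_zero x
    refine TorVanish.succ (antiMap t) (LinearMap.ker e).subtype e ((hF 0).bCoflat t)
      Subtype.val_injective (LinearMap.exact_subtype_ker_map e) he n M
      (ih _ ⟨fun i => F (i + 1), fun i => d (i + 1), (d 0).codRestrict _ hmem,
        fun i => hF _, ?_, ?_, fun i => hd _, fun i hi => h0 _ (by lia)⟩ M)
    · rintro ⟨x, hx⟩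
      obtain ⟨y, hy⟩ := (hde x).1 hx
      exact ⟨y, Subtype.ext hy⟩
    · intro x
      rw [← hd 0 x, Subtype.ext_iff]
      rfl

/-! ### Flat dimension and splicing of resolutions -/

theorem HasFlatResolution.mono {M : Type u} [AddCommGroup M] [Module R M] {m n : ℕ}
    (hmn : m ≤ n) (h : HasFlatResolution R M m) : HasFlatResolution R M n := by
  obtain ⟨F, d, e, h1, h2, h3, h4, h5⟩ := h
  exact ⟨F, d, e, h1, h2, h3, h4, fun i hi => h5 i (hmn.trans_lt hi)⟩

theorem flatDim_le_iff {M : Type u} [AddCommGroup M] [Module R M] {n : ℕ} :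
    flatDim R M ≤ n ↔ HasFlatResolution R M n := by
  constructor
  · intro h
    -- A strict bound by `n + 1` extracts from the infimum a resolution of some length at most `n`.
    have h' : flatDim R M < ((n + 1 : ℕ) : ℕ∞) := h.trans_lt (by exact_mod_cast n.lt_succ_self)
    simp only [flatDim, iInf_lt_iff] at h'
    obtain ⟨m, hm, hlt⟩ := h'
    exact hm.mono (Nat.lt_succ_iff.1 (by exact_mod_cast hlt))
  · exact fun h => iInf₂_le n h

theorem isFlat_of_subsingleton (M : Type u) [AddCommGroup M] [Module R M] [Subsingleton M] :
    IsFlat R M := by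
  intro N N' _ _ _ _ f hf
  have : Subsingleton (TensorProduct ℤ N M) := by
    refine ⟨fun x y => ?_⟩
    have : ∀ z : TensorProduct ℤ N M, z = 0 := by
      intro z
      induction z with
      | zero => rfl
      | tmul n m => rw [Subsingleton.elim m 0, TensorProduct.tmul_zero]
      | add a b ha hb => rw [ha, hb, add_zero]
    rw [this x, this y]
  have : Subsingleton (RingTensor R N M) := (Submodule.mkQ_surjective _).subsingleton
  exact Function.injective_of_subsingleton _

/-- The sequence of modules `P, F 0, F 1, …`. -/
def consModule (P : ModuleCat.{u} R) (F : ℕ → ModuleCat.{u} R) : ℕ → ModuleCat.{u} R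
  | 0 => P
  | n + 1 => F n

/-- The sequence of homomorphisms `j, d 0, d 1, …`. -/
def consMap (P : ModuleCat.{u} R) (F : ℕ → ModuleCat.{u} R) (j : F 0 →ₗ[R] P)
    (d : ∀ i, F (i + 1) →ₗ[R] F i) :
    ∀ i, consModule P F (i + 1) →ₗ[R] consModule P F i
  | 0 => j
  | n + 1 => d n

theorem HasFlatResolution.of_isFlat {M : Type u} [AddCommGroup M] [Module R M]
    (h : IsFlat R M) : HasFlatResolution R M 0 := by
  let Z : ℕ → ModuleCat.{u} R := fun _ => ModuleCat.of R PUnit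
  have hZ : ∀ i, Subsingleton (Z i) := fun i => inferInstanceAs (Subsingleton PUnit)
  refine ⟨consModule (ModuleCat.of R M) Z, consMap (ModuleCat.of R M) Z 0 fun _ => 0,
    LinearMap.id, ?_, Function.surjective_id, ?_, ?_, ?_⟩
  · rintro (_ | i)
    · exact h
    · exact isFlat_of_subsingleton (R := R) (Z i)
  · intro x
    constructor
    · rintro rfl
      exact ⟨0, rfl⟩
    · rintro ⟨y, rfl⟩
      rfl
  · rintro i (x : Z i)
    refine ⟨fun _ => ⟨0, (map_zero _).trans ((hZ i).elim _ _)⟩, fun _ => ?_⟩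
    rw [(hZ i).elim x 0]
    exact map_zero _
  · rintro (_ | i) hi
    · exact absurd hi (lt_irrefl 0)
    · exact hZ i

theorem HasFlatResolution.succ {K P M : Type u} [AddCommGroup K] [Module R K]
    [AddCommGroup P] [Module R P] [AddCommGroup M] [Module R M] (i : K →ₗ[R] P) (p : P →ₗ[R] M)
    (hP : IsFlat R P) (hi : Function.Injective i) (hip : Function.Exact i p)
    (hp : Function.Surjective p) {n : ℕ} (h : HasFlatResolution R K n) :
    HasFlatResolution R M (n + 1) := by
  obtain ⟨F, d, e, hF, he, hde, hd, h0⟩ := h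
  refine ⟨consModule (ModuleCat.of R P) F, consMap (ModuleCat.of R P) F (i ∘ₗ e) d, p, ?_, hp, ?_, ?_, ?_⟩
  · rintro (_ | n)
    · exact hP
    · exact hF n
  · intro x
    refine (hip x).trans ?_
    constructor
    · rintro ⟨y, rfl⟩
      obtain ⟨z, rfl⟩ := he y
      exact ⟨z, rfl⟩
    · rintro ⟨z, rfl⟩
      exact ⟨e z, rfl⟩
  · rintro (_ | n)
    · intro x
      exact (map_eq_zero_iff i hi).trans (hde x)
    · exact hd n
  · rintro (_ | n) hn
    · exact absurd hn (Nat.not_lt_zero _)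
    · exact h0 n (by lia)

end Resolutions

/-! ### Homogeneous components -/

section Decompositions

universe w₁ w₂ w₃ w₄

/-- The homogeneous components with respect to a direct sum decomposition `M = ⨁ M_γ`. -/
structure Decomp {Γ : Type w₁} {M : Type w₂} [AddCommGroup M] (ℳ : Γ → AddSubgroup M) where
  /-- The family of homogeneous components of an element. -/
  dec : M →+ (Γ →₀ M)
  mem : ∀ m γ, dec m γ ∈ ℳ γ
  sum_dec : ∀ m, ((dec m).sum fun _ x => x) = m
  of_mem : ∀ γ m, m ∈ ℳ γ → dec m = Finsupp.single γ m

namespace Decomp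

variable {Γ : Type w₁} {M : Type w₂} [AddCommGroup M] {ℳ : Γ → AddSubgroup M}

theorem dec_sum (D : Decomp ℳ) (g : Γ →₀ M) (hg : ∀ γ, g γ ∈ ℳ γ) :
    D.dec (g.sum fun _ x => x) = g := by
  rw [Finsupp.sum, map_sum, Finset.sum_congr rfl fun γ _ => D.of_mem γ _ (hg γ)]
  exact Finsupp.sum_single g

/-- The images of the components of `m` are homogeneous and add up to `φ m`; decompositions are
unique. -/
theorem dec_map {Γ : Type w₁} {M : Type w₂} {M' : Type w₃} [AddCommGroup M] [AddCommGroup M']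
    {ℳ : Γ → AddSubgroup M} {ℳ' : Γ → AddSubgroup M'} (D : Decomp ℳ) (D' : Decomp ℳ')
    (φ : M →+ M') (hφ : ∀ γ m, m ∈ ℳ γ → φ m ∈ ℳ' γ) (m : M) (γ : Γ) :
    D'.dec (φ m) γ = φ (D.dec m γ) := by
  have h := D'.dec_sum ((D.dec m).mapRange φ (map_zero φ)) fun γ => hφ γ _ (D.mem m γ)
  rw [Finsupp.sum_mapRange_index (fun _ => rfl), Finsupp.sum, ← map_sum] at h
  have h' := D.sum_dec m
  rw [Finsupp.sum] at h'
  rw [h'] at h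
  rw [h, Finsupp.mapRange_apply]

-- Component maps with values in `Γ →₀ M` avoid dependent types, so transport, restriction and
-- quotients become computations with finitely supported functions.
open Classical in
theorem nonempty_iff_isInternal : Nonempty (Decomp ℳ) ↔ DirectSum.IsInternal ℳ := by
  have key : ∀ (x : DirectSum Γ fun γ => ℳ γ) (γ : Γ),
      (DirectSum.toAddMonoid fun γ => (Finsupp.singleAddHom γ).comp (ℳ γ).subtype) x γ
        = (x γ : M) := by
    intro x γ
    induction x using DirectSum.induction_on with
    | zero => simp
    | add x y hx hy => rw [map_add, Finsupp.add_apply, hx, hy]; simp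
    | of i m =>
      rw [DirectSum.toAddMonoid_of]
      by_cases h : i = γ
      · subst h
        simp
      · simp [Finsupp.single_eq_of_ne' h, DirectSum.of_eq_of_ne _ _ _ (Ne.symm h)]
  constructor
  · rintro ⟨D⟩
    have hdec : ∀ x : DirectSum Γ fun γ => ℳ γ, D.dec (DirectSum.coeAddMonoidHom ℳ x) =
        (DirectSum.toAddMonoid fun γ => (Finsupp.singleAddHom γ).comp (ℳ γ).subtype) x := by
      intro x
      induction x using DirectSum.induction_on with
      | zero => simp
      | add x y hx hy => rw [map_add, map_add, map_add, hx, hy]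
      | of i m =>
        rw [DirectSum.coeAddMonoidHom_of, DirectSum.toAddMonoid_of, D.of_mem i m m.2]
        rfl
    constructor
    · rw [injective_iff_map_eq_zero]
      intro x hx
      refine DFinsupp.ext fun γ => Subtype.ext ?_
      rw [← key, ← hdec, hx]
      simp
    · intro m
      refine ⟨(D.dec m).sum fun γ _ => DirectSum.of (fun γ => ℳ γ) γ ⟨D.dec m γ, D.mem m γ⟩, ?_⟩
      rw [Finsupp.sum, map_sum]
      simp only [DirectSum.coeAddMonoidHom_of]
      exact D.sum_dec m
  · intro h
    let e := AddEquiv.ofBijective (DirectSum.coeAddMonoidHom ℳ) h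
    let s : (DirectSum Γ fun γ => ℳ γ) →+ (Γ →₀ M) :=
      DirectSum.toAddMonoid fun γ => (Finsupp.singleAddHom γ).comp (ℳ γ).subtype
    refine ⟨s.comp e.symm.toAddMonoidHom, fun m γ => ?_, fun m => ?_, fun γ m hm => ?_⟩
    · change s (e.symm m) γ ∈ ℳ γ
      rw [key]
      exact (e.symm m γ).2
    · obtain ⟨x, rfl⟩ := e.surjective m
      change ((s (e.symm (e x))).sum fun _ x => x) = DirectSum.coeAddMonoidHom ℳ x
      rw [e.symm_apply_apply]
      induction x using DirectSum.induction_on with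
      | zero => simp
      | add x y hx hy =>
        rw [map_add, Finsupp.sum_add_index' (fun _ => rfl) (fun _ _ _ => rfl), hx, hy, map_add]
      | of i m =>
        simp only [s, DirectSum.toAddMonoid_of, DirectSum.coeAddMonoidHom_of]
        exact Finsupp.sum_single_index rfl
    · have : e.symm m = DirectSum.of (fun γ => ℳ γ) γ ⟨m, hm⟩ := by
        rw [AddEquiv.symm_apply_eq]
        exact (DirectSum.coeAddMonoidHom_of ℳ γ ⟨m, hm⟩).symm
      change s (e.symm m) = _
      rw [this]
      simp only [s, DirectSum.toAddMonoid_of]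
      rfl

/-- Transport of a decomposition along isomorphisms of the index sets and of the groups. -/
def transport {Γ' : Type w₃} {M' : Type w₄} [AddCommGroup M'] {ℳ' : Γ' → AddSubgroup M'}
    (D : Decomp ℳ) (σ : Γ ≃ Γ') (e : M ≃+ M') (h : ∀ γ m, m ∈ ℳ γ ↔ e m ∈ ℳ' (σ γ)) :
    Decomp ℳ' where
  dec := ((Finsupp.mapRange.addMonoidHom e.toAddMonoidHom).comp
    (Finsupp.mapDomain.addMonoidHom σ)).comp (D.dec.comp e.symm.toAddMonoidHom)
  mem m γ := by
    obtain ⟨γ, rfl⟩ := σ.surjective γ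
    have : Finsupp.mapDomain σ (D.dec (e.symm m)) (σ γ) = D.dec (e.symm m) γ :=
      Finsupp.mapDomain_apply σ.injective _ _
    simpa [this] using (h γ _).1 (D.mem (e.symm m) γ)
  sum_dec m := by
    have h' := D.sum_dec (e.symm m)
    change ((Finsupp.mapDomain σ (D.dec (e.symm m))).mapRange e (map_zero e)).sum
      (fun _ x => x) = m
    rw [Finsupp.sum_mapRange_index (fun _ => rfl),
      Finsupp.sum_mapDomain_index (fun _ => map_zero e) (fun _ _ _ => map_add e _ _),
      Finsupp.sum, ← map_sum]
    rw [Finsupp.sum] at h'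
    rw [h', e.apply_symm_apply]
  of_mem γ m hm := by
    obtain ⟨γ, rfl⟩ := σ.surjective γ
    obtain ⟨m, rfl⟩ := e.surjective m
    change (Finsupp.mapDomain σ (D.dec (e.symm (e m)))).mapRange e (map_zero e) = _
    rw [e.symm_apply_apply, D.of_mem γ m ((h γ m).2 hm), Finsupp.mapDomain_single,
      Finsupp.mapRange_single]

/-- The grading of a submodule by its homogeneous elements. -/
def restrictGrading {R : Type w₃} [Ring R] [Module R M] (ℳ : Γ → AddSubgroup M)
    (K : Submodule R M) (γ : Γ) : AddSubgroup K :=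
  (ℳ γ).comap K.subtype.toAddMonoidHom

/-- The induced decomposition of a submodule that contains the components of its elements. -/
def restrict {R : Type w₃} [Ring R] [Module R M] (D : Decomp ℳ) (K : Submodule R M)
    (hK : ∀ k ∈ K, ∀ γ, D.dec k γ ∈ K) :
    Decomp (restrictGrading ℳ K) where
  dec := AddMonoidHom.mk' (fun k => ⟨(D.dec k).support, fun γ => ⟨D.dec k γ, hK k k.2 γ⟩,
      fun γ => by simp [Subtype.ext_iff]⟩)
    (fun k k' => by ext γ; simp)
  mem k γ := D.mem k γ
  sum_dec k := by
    refine Subtype.ext ?_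
    conv_rhs => rw [← D.sum_dec k]
    exact map_sum K.subtype _ _
  of_mem γ k hk := by
    ext δ
    change D.dec k δ = _
    rw [D.of_mem γ k hk]
    by_cases h : γ = δ
    · subst h
      simp
    · simp [Finsupp.single_eq_of_ne' h]

/-- The induced decomposition of the quotient by a subgroup that contains the components of its
elements. -/
def quotient {R : Type w₃} [Ring R] [Module R M] (D : Decomp ℳ) (K : Submodule R M)
    (hK : ∀ k ∈ K, ∀ γ, D.dec k γ ∈ K) :
    Decomp fun γ => (ℳ γ).map K.mkQ.toAddMonoidHom where
  dec := QuotientAddGroup.lift K.toAddSubgroup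
    ((Finsupp.mapRange.addMonoidHom K.mkQ.toAddMonoidHom).comp D.dec) (fun k hk => by
      ext γ
      exact (Submodule.Quotient.mk_eq_zero K).2 (hK k hk γ))
  mem m γ := by
    obtain ⟨m, rfl⟩ := K.mkQ_surjective m
    exact ⟨_, D.mem m γ, rfl⟩
  sum_dec m := by
    obtain ⟨m, rfl⟩ := K.mkQ_surjective m
    change (((D.dec m).mapRange K.mkQ (map_zero _)).sum fun _ x => x) = _
    rw [Finsupp.sum_mapRange_index (fun _ => rfl), Finsupp.sum, ← map_sum]
    exact congrArg _ (D.sum_dec m)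
  of_mem γ m hm := by
    obtain ⟨m, hm, rfl⟩ := hm
    change (D.dec m).mapRange K.mkQ (map_zero _) = _
    rw [D.of_mem γ m hm, Finsupp.mapRange_single]
    rfl

end Decomp

/-! ### Graded modules over a graded ring -/

variable {Γ : Type v} [CancelMonoid Γ] {R : Type u} [Ring R]

/-- A left module graded by a monoid, with its homogeneous components. -/
structure GradedMod (𝒜 : Γ → AddSubgroup R) {M : Type w₁} [AddCommGroup M] [Module R M]
    (ℳ : Γ → AddSubgroup M) extends Decomp ℳ where
  smul_mem : ∀ (α β : Γ) (a : R) (m : M), a ∈ 𝒜 α → m ∈ ℳ β → a • m ∈ ℳ (α * β)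

namespace GradedMod

variable {𝒜 : Γ → AddSubgroup R} {M : Type w₁} [AddCommGroup M] [Module R M]
  {ℳ : Γ → AddSubgroup M}

theorem dec_smul (G : GradedMod 𝒜 ℳ) {α : Γ} {a : R} (ha : a ∈ 𝒜 α) (m : M) :
    G.dec (a • m) = (G.dec m).sum fun β x => Finsupp.single (α * β) (a • x) := by
  conv_lhs => rw [← G.sum_dec m]
  rw [Finsupp.sum, Finset.smul_sum, map_sum]
  exact Finset.sum_congr rfl fun β _ => G.of_mem _ _ (G.smul_mem α β a _ ha (G.mem m β))

/-- By left cancellation `β` is the only degree that `a` carries to `α * β`. -/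
theorem dec_smul_apply (G : GradedMod 𝒜 ℳ) {α : Γ} {a : R} (ha : a ∈ 𝒜 α) (m : M) (β : Γ) :
    G.dec (a • m) (α * β) = a • G.dec m β := by
  rw [G.dec_smul ha, Finsupp.sum_apply, Finsupp.sum, Finset.sum_eq_single β]
  · simp
  · intro γ _ hγ
    exact Finsupp.single_eq_of_ne fun h => hγ (mul_left_cancel h).symm
  · intro h
    rw [Finsupp.notMem_support_iff.1 h]
    simp

/-- Each component of `a • x` is a sum of products of a component of `a` with a component of `x`, so
the condition survives scalar multiplication. -/
theorem dec_mem_of_span (G : GradedMod 𝒜 ℳ) (GR : GradedMod 𝒜 𝒜) (S : Set M)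
    (hS : ∀ s ∈ S, ∃ γ, s ∈ ℳ γ) :
    ∀ x ∈ Submodule.span R S, ∀ γ, G.dec x γ ∈ Submodule.span R S := by
  intro x hx
  induction hx using Submodule.span_induction with
  | mem x hx =>
    obtain ⟨δ, hδ⟩ := hS x hx
    intro γ
    rw [G.of_mem δ x hδ]
    by_cases h : δ = γ
    · subst h
      simpa using Submodule.subset_span hx
    · simp [Finsupp.single_eq_of_ne' h]
  | zero => simp
  | add x y _ _ hx hy =>
    intro γ
    rw [map_add, Finsupp.add_apply]
    exact add_mem (hx γ) (hy γ)
  | smul a x _ hx =>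
    intro γ
    rw [← GR.sum_dec a, Finsupp.sum, Finset.sum_smul, map_sum, Finsupp.finsetSum_apply]
    refine sum_mem fun α _ => ?_
    rw [G.dec_smul (GR.mem a α), Finsupp.sum_apply]
    refine sum_mem fun β _ => ?_
    by_cases h : α * β = γ
    · subst h
      simpa using Submodule.smul_mem _ _ (hx β)
    · simp [Finsupp.single_eq_of_ne' h]

/-- The graded quotient by a submodule generated by homogeneous elements. -/
def quotientSpan (G : GradedMod 𝒜 ℳ) (GR : GradedMod 𝒜 𝒜) (S : Set M)
    (hS : ∀ s ∈ S, ∃ γ, s ∈ ℳ γ) :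
    GradedMod 𝒜 fun γ => (ℳ γ).map (Submodule.span R S).mkQ.toAddMonoidHom where
  toDecomp := G.quotient _ (G.dec_mem_of_span GR S hS)
  smul_mem := by
    rintro α β a _ ha ⟨m, hm, rfl⟩
    exact ⟨a • m, G.smul_mem α β a m ha hm, rfl⟩

/-- The kernel of a graded homomorphism is graded. -/
def ker {M' : Type w₂} [AddCommGroup M'] [Module R M'] {ℳ' : Γ → AddSubgroup M'}
    (G : GradedMod 𝒜 ℳ) (G' : GradedMod 𝒜 ℳ') (p : M →ₗ[R] M')
    (hp : ∀ γ m, m ∈ ℳ γ → p m ∈ ℳ' γ) :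
    GradedMod 𝒜 (Decomp.restrictGrading ℳ (LinearMap.ker p)) where
  toDecomp := G.restrict _ fun k hk γ => by
    rw [LinearMap.mem_ker] at hk ⊢
    have := G.dec_map G'.toDecomp p.toAddMonoidHom hp k γ
    simpa [hk] using this.symm
  smul_mem α β a m ha hm := G.smul_mem α β a m ha hm

end GradedMod

/-! ### Graded free modules -/

section Free

variable (𝒜 : Γ → AddSubgroup R)

/-- The coefficients that carry degree `δ` into degree `γ`. -/
def shiftGrading (δ γ : Γ) : AddSubgroup R := ⨆ (α : Γ) (_ : α * δ = γ), 𝒜 α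

variable {𝒜}

theorem mem_shiftGrading {α δ γ : Γ} (h : α * δ = γ) {r : R} (hr : r ∈ 𝒜 α) :
    r ∈ shiftGrading 𝒜 δ γ :=
  (le_iSup₂_of_le (f := fun (α : Γ) (_ : α * δ = γ) => 𝒜 α) α h le_rfl) hr

/-- Right cancellation leaves at most one `α` in the supremum. The case `r = 0` covers degrees `γ`
outside `Γδ`, since `δ` need not be invertible. -/
theorem shiftGrading_cases {δ γ : Γ} {r : R} (hr : r ∈ shiftGrading 𝒜 δ γ) :
    r = 0 ∨ ∃ α, α * δ = γ ∧ r ∈ 𝒜 α := by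
  by_cases h : ∃ α, α * δ = γ
  · obtain ⟨α, rfl⟩ := h
    have : shiftGrading 𝒜 δ (α * δ) ≤ 𝒜 α :=
      iSup₂_le fun β hβ => (congrArg 𝒜 (mul_right_cancel hβ)).le
    exact Or.inr ⟨α, rfl, this hr⟩
  · have : shiftGrading 𝒜 δ γ ≤ ⊥ := iSup₂_le fun β hβ => absurd ⟨β, hβ⟩ h
    exact Or.inl (AddSubgroup.mem_bot.1 (this hr))

variable (𝒜) in
/-- The grading of the free module on generators of degrees `d i`. -/
def freeGrading {ι : Type w₁} (d : ι → Γ) (γ : Γ) : AddSubgroup (ι →₀ R) where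
  carrier := {f | ∀ i, f i ∈ shiftGrading 𝒜 (d i) γ}
  zero_mem' _ := zero_mem _
  add_mem' hf hg i := add_mem (hf i) (hg i)
  neg_mem' hf i := neg_mem (hf i)

theorem single_mem_freeGrading {ι : Type w₁} (d : ι → Γ) (α : Γ) (i : ι) {r : R} (hr : r ∈ 𝒜 α) :
    Finsupp.single i r ∈ freeGrading 𝒜 d (α * d i) := by
  intro j
  by_cases h : i = j
  · subst h
    simpa using mem_shiftGrading rfl hr
  · rw [Finsupp.single_eq_of_ne' h]
    exact zero_mem _

/-- The free module on generators of degrees `d i` is graded. -/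
def freeGradedMod (GR : GradedMod 𝒜 𝒜) {ι : Type w₁} (d : ι → Γ) :
    GradedMod 𝒜 (freeGrading 𝒜 d) where
  dec := Finsupp.liftAddHom fun i =>
    ((Finsupp.mapRange.addMonoidHom (Finsupp.singleAddHom i)).comp
      (Finsupp.mapDomain.addMonoidHom (· * d i))).comp GR.dec
  mem f γ := by
    induction f using Finsupp.induction_linear with
    | zero => simp [zero_mem]
    | add f g hf hg => rw [map_add]; exact add_mem hf hg
    | single i r =>
      rw [Finsupp.liftAddHom_apply_single]
      change Finsupp.single i (Finsupp.mapDomain (· * d i) (GR.dec r) γ) ∈ _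
      by_cases h : ∃ α, α * d i = γ
      · obtain ⟨α, rfl⟩ := h
        -- Right multiplication by `d i` is injective, so distinct components of `r` stay in
        -- distinct degrees.
        have : Finsupp.mapDomain (· * d i) (GR.dec r) (α * d i) = GR.dec r α :=
          Finsupp.mapDomain_apply (mul_left_injective (d i)) _ _
        rw [this]
        exact single_mem_freeGrading d α i (GR.mem r α)
      · rw [Finsupp.mapDomain_of_notMem_range _ _ (by rintro ⟨α, hα⟩; exact h ⟨α, hα⟩),
          Finsupp.single_zero]
        exact zero_mem _
  sum_dec f := by
    induction f using Finsupp.induction_linear with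
    | zero => simp
    | add f g hf hg =>
      rw [map_add, Finsupp.sum_add_index' (fun _ => rfl) (fun _ _ _ => rfl), hf, hg]
    | single i r =>
      rw [Finsupp.liftAddHom_apply_single]
      change ((Finsupp.mapDomain (· * d i) (GR.dec r)).mapRange (Finsupp.single i)
        (Finsupp.single_zero i)).sum (fun _ x => x) = _
      rw [Finsupp.sum_mapRange_index (fun _ => rfl),
        Finsupp.sum_mapDomain_index (fun _ => Finsupp.single_zero i)
          (fun _ _ _ => Finsupp.single_add i _ _)]
      conv_rhs => rw [← GR.sum_dec r]
      exact (map_sum (Finsupp.singleAddHom i) _ _).symm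
  of_mem γ f hf := by
    rw [Finsupp.liftAddHom_apply, Finsupp.sum]
    have : ∀ i ∈ f.support, (((Finsupp.mapRange.addMonoidHom (Finsupp.singleAddHom i)).comp
        (Finsupp.mapDomain.addMonoidHom (· * d i))).comp GR.dec) (f i) =
        Finsupp.singleAddHom γ (Finsupp.single i (f i)) := by
      intro i _
      obtain h | ⟨α, rfl, hα⟩ := shiftGrading_cases (hf i)
      · rw [h]
        simp
      · change (Finsupp.mapDomain (· * d i) (GR.dec (f i))).mapRange (Finsupp.single i)
          (Finsupp.single_zero i) = _
        rw [GR.of_mem α _ hα, Finsupp.mapDomain_single, Finsupp.mapRange_single]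
        rfl
    rw [Finset.sum_congr rfl this, ← map_sum]
    exact congrArg _ (Finsupp.sum_single f)
  smul_mem α β a f ha hf i := by
    obtain h | ⟨δ, rfl, hδ⟩ := shiftGrading_cases (hf i)
    · rw [Finsupp.smul_apply, h, smul_zero]
      exact zero_mem _
    · exact mem_shiftGrading (mul_assoc α δ (d i)) (GR.smul_mem α δ a _ ha hδ)

/-- A linear combination of elements of degrees `d i` is graded. -/
theorem linearCombination_mem {ι : Type w₁} (d : ι → Γ) {M : Type w₂} [AddCommGroup M]
    [Module R M] {ℳ : Γ → AddSubgroup M} (G : GradedMod 𝒜 ℳ) (y : ι → M)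
    (hy : ∀ i, y i ∈ ℳ (d i)) (γ : Γ) (f : ι →₀ R) (hf : f ∈ freeGrading 𝒜 d γ) :
    Finsupp.linearCombination R y f ∈ ℳ γ := by
  rw [Finsupp.linearCombination_apply]
  refine sum_mem fun i _ => ?_
  obtain h | ⟨α, rfl, hα⟩ := shiftGrading_cases (hf i)
  · simp only [h, zero_smul, zero_mem]
  · exact G.smul_mem α (d i) _ _ hα (hy i)

end Free

end Decompositions

/-! ### The flatness criterion by homogeneous right ideals -/

section Criterion

variable {A R : Type u} [Ring A] [Ring R]

/-- The additive map `q : R → N` exhibits the `A`-module `N` as the quotient of `R` by the right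
ideal generated by `S`. -/
structure IsRightQuotient (t : A ≃+* Rᵐᵒᵖ) (S : Set R) {N : Type u} [AddCommGroup N] [Module A N]
    (q : R →+ N) : Prop where
  surjective : Function.Surjective q
  map_mul : ∀ x a, q (x * antiMap t a) = a • q x
  map_gen : ∀ s ∈ S, q s = 0
  ker_le : ∀ x, q x = 0 → x ∈ AddSubgroup.closure {y | ∃ s ∈ S, ∃ b, y = s * b}

/-- If `Tor_1(R/SR, M) = 0` and `M = P/K` with `P` flat, then `K ∩ SP = SK`. -/
theorem IsRightQuotient.mem_closure_smul {t : A ≃+* Rᵐᵒᵖ} {S : Set R} {N : Type u}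
    [AddCommGroup N] [Module A N] {q : R →+ N} (hq : IsRightQuotient t S q)
    {K P : Type u} [AddCommGroup K] [Module R K] [AddCommGroup P] [Module R P] (i : K →ₗ[R] P)
    (hi : Function.Injective (mapR (antiMap t) N i)) (k : K)
    (hk : i k ∈ AddSubgroup.closure {y : P | ∃ s ∈ S, ∃ x, y = s • x}) :
    k ∈ AddSubgroup.closure {y : K | ∃ s ∈ S, ∃ x, y = s • x} := by
  set SK := AddSubgroup.closure {y : K | ∃ s ∈ S, ∃ x, y = s • x}
  -- In `N ⊗ P` one has `q 1 ⊗ s x = q s ⊗ x = 0`.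
  have hP : ∀ y ∈ AddSubgroup.closure {y : P | ∃ s ∈ S, ∃ x, y = s • x},
      btmul (antiMap t) (q 1) y = 0 := by
    intro y hy
    induction hy using AddSubgroup.closure_induction with
    | mem y hy =>
      obtain ⟨s, hs, x, rfl⟩ := hy
      rw [← antiMap_symm t s, ← btmul_smul, ← hq.map_mul, one_mul, antiMap_symm, hq.map_gen s hs,
        btmul_zero_left]
    | zero => exact btmul_zero_right _ _
    | add x y _ _ hx hy => rw [btmul_add_right, hx, hy, add_zero]
    | neg x _ hx =>
      have := btmul_add_right (antiMap t) (q 1) (-x) x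
      rw [hx, neg_add_cancel, btmul_zero_right, add_zero] at this
      exact this.symm
  have h0 : btmul (antiMap t) (q 1) k = 0 := by
    apply hi
    rw [mapR_btmul, hP _ hk, map_zero]
  -- The map `q r ⊗ k ↦ r k mod SK` detects membership in `SK`. It is well defined because elements
  -- of `ker q` are sums of terms `± s b`, which carry `K` into `SK`.
  let ρ : R →+ K →+ K ⧸ SK := AddMonoidHom.mk' (fun r => (QuotientAddGroup.mk' SK).comp
    (DistribSMul.toAddMonoidHom K r)) (fun r r' => by ext; simp [add_smul])
  have hρ : ∀ r k, ρ r k = QuotientAddGroup.mk' SK (r • k) := fun _ _ => rfl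
  have hker : q.ker ≤ ρ.ker := by
    intro r hr
    rw [AddMonoidHom.mem_ker] at hr ⊢
    have hr' := hq.ker_le r hr
    clear hr
    induction hr' using AddSubgroup.closure_induction with
    | mem y hy =>
      obtain ⟨s, hs, b, rfl⟩ := hy
      ext k
      rw [hρ, mul_smul]
      exact (QuotientAddGroup.eq_zero_iff _).2
        (AddSubgroup.subset_closure ⟨s, hs, b • k, rfl⟩)
    | zero => simp
    | add x y _ _ hx hy => rw [map_add, hx, hy, add_zero]
    | neg x _ hx => rw [map_neg, hx, neg_zero]
  let ρ' : N →+ K →+ K ⧸ SK := q.liftOfSurjective hq.surjective ⟨ρ, hker⟩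
  have hρ' : ∀ r, ρ' (q r) = ρ r := fun r => AddMonoidHom.liftOfRightInverse_comp_apply _ _ _ _ r
  let Φ : BTensor (antiMap t) N K →ₗ[ℤ] K ⧸ SK := (bRel (antiMap t) N K).liftQ
    (TensorProduct.liftAddHom ρ' (fun r n k => by
      rw [map_zsmul, map_zsmul]; rfl)).toIntLinearMap (by
    refine Submodule.span_le.2 ?_
    rintro _ ⟨n, a, k, rfl⟩
    rw [SetLike.mem_coe, LinearMap.mem_ker, map_sub, sub_eq_zero]
    change ρ' (a • n) k = ρ' n (antiMap t a • k)
    obtain ⟨r, rfl⟩ := hq.surjective n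
    rw [← hq.map_mul, hρ', hρ', hρ, hρ, mul_smul])
  have hΦ : Φ (btmul (antiMap t) (q 1) k) = ρ' (q 1) k := rfl
  rw [h0, map_zero, hρ', hρ, one_smul] at hΦ
  exact (QuotientAddGroup.eq_zero_iff k).1 hΦ.symm

variable {Γ : Type v} [CancelMonoid Γ] {𝒜 : Γ → AddSubgroup R}

/-- Local splitting of the kernel of a graded free cover at one homogeneous element. -/
theorem exists_graded_retraction_single {ι : Type u} (d : ι → Γ)
    {K : Submodule R (ι →₀ R)}
    (GK : GradedMod 𝒜 (Decomp.restrictGrading (freeGrading 𝒜 d) K))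
    (H : ∀ S : Set R, (∀ s ∈ S, ∃ α, s ∈ 𝒜 α) → ∀ k : K,
      (k : ι →₀ R) ∈ AddSubgroup.closure {y : ι →₀ R | ∃ s ∈ S, ∃ x, y = s • x} →
        k ∈ AddSubgroup.closure {y : K | ∃ s ∈ S, ∃ x, y = s • x})
    (δ : Γ) (k : K) (hk : (k : ι →₀ R) ∈ freeGrading 𝒜 d δ) :
    ∃ θ : (ι →₀ R) →ₗ[R] K, (∀ γ, ∀ f ∈ freeGrading 𝒜 d γ,
      (θ f : ι →₀ R) ∈ freeGrading 𝒜 d γ) ∧ θ k = k := by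
  have hcoef : ∀ i, (k : ι →₀ R) i = 0 ∨ ∃ α, α * d i = δ ∧ (k : ι →₀ R) i ∈ 𝒜 α :=
    fun i => shiftGrading_cases (hk i)
  -- The test set `S` consists of the coordinates of `k`, and `k` is the sum of `k i` times the
  -- basis vectors.
  have hk' : (k : ι →₀ R) ∈ AddSubgroup.closure
      {y : ι →₀ R | ∃ s ∈ Set.range (k : ι →₀ R), ∃ x, y = s • x} := by
    have hsum := Finsupp.sum_single (k : ι →₀ R)
    rw [Finsupp.sum] at hsum
    rw [← hsum]
    refine sum_mem fun i _ => AddSubgroup.subset_closure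
      ⟨_, ⟨i, rfl⟩, Finsupp.single i 1, ?_⟩
    rw [Finsupp.smul_single, smul_eq_mul, mul_one, hsum]
  have hmem : k ∈ AddSubgroup.closure
      {y : K | ∃ s ∈ Set.range (k : ι →₀ R), ∃ x : K, y = s • x} :=
    H _ (by
      rintro _ ⟨i, rfl⟩
      obtain h | ⟨α, -, h⟩ := hcoef i
      -- Zero lies in every component; degree `1` is an arbitrary choice.
      · exact ⟨1, h ▸ zero_mem _⟩
      · exact ⟨α, h⟩) k hk'
  let c : (ι → K) →+ K := AddMonoidHom.mk'
    (fun y => ∑ i ∈ (k : ι →₀ R).support, (k : ι →₀ R) i • y i)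
    (fun y z => by simp [smul_add, Finset.sum_add_distrib])
  have hc : AddSubgroup.closure {y : K | ∃ s ∈ Set.range (k : ι →₀ R), ∃ x, y = s • x} ≤
      AddMonoidHom.range (G := ι → K) c := by
    rw [AddSubgroup.closure_le]
    rintro _ ⟨_, ⟨i, rfl⟩, x, rfl⟩
    classical
    refine ⟨Pi.single i x, ?_⟩
    change ∑ j ∈ (k : ι →₀ R).support, (k : ι →₀ R) j • (Pi.single i x : ι → K) j = _
    rw [Finset.sum_eq_single i]
    · rw [Pi.single_eq_same]
    · intro j _ hj
      rw [Pi.single_eq_of_ne hj, smul_zero]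
    · intro hi
      rw [Finsupp.notMem_support_iff.1 hi, zero_smul]
  obtain ⟨y, hy⟩ := hc hmem
  change ∑ i ∈ (k : ι →₀ R).support, (k : ι →₀ R) i • y i = k at hy
  -- A nonzero `k i` has degree `α` with `α * d i = δ`, so only the component of `y i` in degree `d
  -- i` contributes to `k`. Sending the `i`-th basis vector to it preserves degrees.
  let y' : ι → K := fun i => GK.dec (y i) (d i)
  refine ⟨Finsupp.linearCombination R y', fun γ f hf =>
    linearCombination_mem d GK y' (fun i => GK.mem _ _) γ f hf, ?_⟩
  have h1 : GK.dec k δ = k := by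
    rw [GK.of_mem δ k hk, Finsupp.single_eq_same]
  rw [Finsupp.linearCombination_apply, Finsupp.sum]
  conv_rhs => rw [← h1, ← hy, map_sum, Finsupp.finsetSum_apply]
  refine Finset.sum_congr rfl fun i _ => ?_
  obtain h | ⟨α, rfl, hα⟩ := hcoef i
  · simp [h]
  · exact (GK.dec_smul_apply hα (y i) (d i)).symm

/-- Local splitting at a finite set of homogeneous elements. -/
theorem exists_graded_retraction {ι : Type u} (d : ι → Γ) {K : Submodule R (ι →₀ R)}
    (H : ∀ δ, ∀ k : K, (k : ι →₀ R) ∈ freeGrading 𝒜 d δ →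
      ∃ θ : (ι →₀ R) →ₗ[R] K, (∀ γ, ∀ f ∈ freeGrading 𝒜 d γ,
        (θ f : ι →₀ R) ∈ freeGrading 𝒜 d γ) ∧ θ k = k)
    (l : List K) (hl : ∀ k ∈ l, ∃ δ, (k : ι →₀ R) ∈ freeGrading 𝒜 d δ) :
    ∃ θ : (ι →₀ R) →ₗ[R] K, (∀ γ, ∀ f ∈ freeGrading 𝒜 d γ,
      (θ f : ι →₀ R) ∈ freeGrading 𝒜 d γ) ∧ ∀ k ∈ l, θ k = k := by
  induction l with
  | nil => exact ⟨0, fun γ f _ => zero_mem _, by simp⟩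
  | cons k l ih =>
    obtain ⟨θ₁, hθ₁, hl₁⟩ := ih fun x hx => hl x (List.mem_cons_of_mem _ hx)
    obtain ⟨δ, hδ⟩ := hl k List.mem_cons_self
    -- Since `θ₁` preserves degrees, the error `k - θ₁ k` is again homogeneous. The new map
    -- satisfies `1 - θ = (1 - θ₂)(1 - θ₁)` on `ι →₀ R`, which kills both `l` and `k`.
    obtain ⟨θ₂, hθ₂, hk₂⟩ := H δ (k - θ₁ k) (sub_mem hδ (hθ₁ δ _ hδ))
    refine ⟨θ₁ + θ₂ ∘ₗ (LinearMap.id - K.subtype ∘ₗ θ₁), fun γ f hf => ?_, fun x hx => ?_⟩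
    · exact add_mem (hθ₁ γ f hf) (hθ₂ γ _ (sub_mem hf (hθ₁ γ f hf)))
    · change θ₁ x + θ₂ ((x : ι →₀ R) - θ₁ x) = x
      obtain rfl | hx := List.mem_cons.1 hx
      · rw [← Submodule.coe_sub, hk₂]
        exact add_sub_cancel (θ₁ x) x
      · rw [hl₁ x hx, sub_self, map_zero, add_zero]

/-- A submodule which splits off locally is pure. -/
theorem injective_mapR_of_retraction (t : A → R) {ι : Type u} (d : ι → Γ)
    {K : Submodule R (ι →₀ R)}
    (GK : GradedMod 𝒜 (Decomp.restrictGrading (freeGrading 𝒜 d) K))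
    (H : ∀ l : List K, (∀ k ∈ l, ∃ δ, (k : ι →₀ R) ∈ freeGrading 𝒜 d δ) →
      ∃ θ : (ι →₀ R) →ₗ[R] K, ∀ k ∈ l, θ k = k)
    (N : Type u) [AddCommGroup N] [Module A N] :
    Function.Injective (mapR (M := K) (M' := ι →₀ R) t N K.subtype) := by
  -- A tensor involves finitely many homogeneous elements of `K`, and any `θ` fixing them inverts
  -- the map at `z`.
  have key : ∀ z : BTensor t N K, ∃ l : List K,
      (∀ k ∈ l, ∃ δ, (k : ι →₀ R) ∈ freeGrading 𝒜 d δ) ∧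
      ∀ θ : (ι →₀ R) →ₗ[R] K, (∀ k ∈ l, θ k = k) →
        mapR t N θ (mapR (M := K) (M' := ι →₀ R) t N K.subtype z) = z := by
    intro z
    induction z using BTensor.induction with
    | zero => exact ⟨[], by simp, by simp⟩
    | add x y hx hy =>
      obtain ⟨l, hl, hlx⟩ := hx
      obtain ⟨m, hm, hmy⟩ := hy
      refine ⟨l ++ m, fun k hk => (List.mem_append.1 hk).elim (hl k) (hm k), fun θ hθ => ?_⟩
      rw [map_add, map_add, hlx θ fun k hk => hθ k (List.mem_append_left _ hk),
        hmy θ fun k hk => hθ k (List.mem_append_right _ hk)]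
    | tmul n k =>
      refine ⟨(GK.dec k).support.toList.map (GK.dec k), fun x hx => ?_, fun θ hθ => ?_⟩
      · obtain ⟨γ, -, rfl⟩ := List.mem_map.1 hx
        exact ⟨γ, GK.mem k γ⟩
      · rw [mapR_btmul, mapR_btmul]
        congr 1
        rw [← GK.sum_dec k, Finsupp.sum, map_sum, map_sum]
        exact Finset.sum_congr rfl fun γ hγ =>
          hθ _ (List.mem_map.2 ⟨γ, Finset.mem_toList.2 hγ, rfl⟩)
  rw [injective_iff_map_eq_zero]
  intro z hz
  obtain ⟨l, hl, hlz⟩ := key z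
  obtain ⟨θ, hθ⟩ := H l hl
  rw [← hlz θ hθ, hz, map_zero]

/-- Every graded module has a graded free cover. -/
theorem exists_graded_cover {M : Type u} [AddCommGroup M] [Module R M] {ℳ : Γ → AddSubgroup M}
    (GM : GradedMod 𝒜 ℳ) :
    ∃ (ι : Type u) (d : ι → Γ) (p : (ι →₀ R) →ₗ[R] M), Function.Surjective p ∧
      ∀ γ, ∀ f ∈ freeGrading 𝒜 d γ, p f ∈ ℳ γ := by
  let ι : Type u := {m : M // ∃ γ, m ∈ ℳ γ}
  choose d hd using fun i : ι => i.2
  refine ⟨ι, d, Finsupp.linearCombination R Subtype.val, fun m => ?_,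
    linearCombination_mem d GM _ hd⟩
  rw [← LinearMap.mem_range, ← GM.sum_dec m]
  exact sum_mem fun γ _ => ⟨Finsupp.single ⟨GM.dec m γ, γ, GM.mem m γ⟩ 1, by simp⟩

/-- If `Tor_{n+1}(R/I, M) = 0` for all homogeneous right ideals `I`, then the graded left module
`M` has a flat resolution of length `n`. -/
theorem hasFlatResolution_of_torVanish (t : A ≃+* Rᵐᵒᵖ) (GR : GradedMod 𝒜 𝒜) (n : ℕ) :
    ∀ (M : Type u) [AddCommGroup M] [Module R M] (ℳ : Γ → AddSubgroup M), GradedMod 𝒜 ℳ →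
      (∀ S : Set R, (∀ s ∈ S, ∃ α, s ∈ 𝒜 α) → ∃ (N : Type u) (_ : AddCommGroup N)
        (_ : Module A N) (q : R →+ N), IsRightQuotient t S q ∧ TorVanish (antiMap t) N n M) →
      HasFlatResolution R M n := by
  induction n with
  | zero =>
    intro M _ _ ℳ GM H
    obtain ⟨ι, d, p, hp, hpd⟩ := exists_graded_cover GM
    have hF := bFlat_finsupp t ι
    have hip : Function.Exact (LinearMap.ker p).subtype p := LinearMap.exact_subtype_ker_map p
    have GK := (freeGradedMod GR d).ker GM p hpd
    refine .of_isFlat (BFlat.isFlat t (.of_pure (antiMap t) (K := LinearMap.ker p)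
      (LinearMap.ker p).subtype p hF hip hp fun N _ _ =>
        injective_mapR_of_retraction (antiMap t) d GK (fun l hl => ?_) N))
    obtain ⟨θ, -, hθ⟩ := exists_graded_retraction d
      (exists_graded_retraction_single d GK fun S hS => by
        obtain ⟨N, _, _, q, hq, hT⟩ := H S hS
        exact hq.mem_closure_smul _
          (hT (LinearMap.ker p) _ (LinearMap.ker p).subtype p hF Subtype.val_injective hip hp))
      l hl
    exact ⟨θ, hθ⟩
  | succ n ih =>
    intro M _ _ ℳ GM H
    obtain ⟨ι, d, p, hp, hpd⟩ := exists_graded_cover GM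
    have hF := bFlat_finsupp t ι
    have hip : Function.Exact (LinearMap.ker p).subtype p := LinearMap.exact_subtype_ker_map p
    refine .succ _ p (hF.isFlat t) Subtype.val_injective hip hp
      (ih _ _ ((freeGradedMod GR d).ker GM p hpd) fun S hS => ?_)
    obtain ⟨N, _, _, q, hq, hT⟩ := H S hS
    exact ⟨N, _, _, q, hq, hT _ _ _ p hF Subtype.val_injective hip hp⟩

/-- The weak dimension of graded left modules is bounded by the flat dimensions of the quotients
by homogeneous right ideals. -/
theorem flatDim_le_of_isRightQuotient (t : A ≃+* Rᵐᵒᵖ) (GR : GradedMod 𝒜 𝒜) (c : ℕ∞)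
    (H : ∀ S : Set R, (∀ s ∈ S, ∃ α, s ∈ 𝒜 α) → ∃ (N : Type u) (_ : AddCommGroup N)
      (_ : Module A N) (q : R →+ N), IsRightQuotient t S q ∧ flatDim A N ≤ c)
    {M : Type u} [AddCommGroup M] [Module R M] {ℳ : Γ → AddSubgroup M} (GM : GradedMod 𝒜 ℳ) :
    flatDim R M ≤ c := by
  induction c with
  | top => exact le_top
  | coe n =>
    refine flatDim_le_iff.2 (hasFlatResolution_of_torVanish t GR n M ℳ GM fun S hS => ?_)
    obtain ⟨N, _, _, q, hq, hN⟩ := H S hS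
    exact ⟨N, _, _, q, hq, (flatDim_le_iff.1 hN).torVanish t n N M⟩

end Criterion

/-! ### Opposite gradings and the cycle of inequalities -/

section Main

open MulOpposite

variable {Γ : Type v} [CancelMonoid Γ] {R : Type u} [Ring R] {𝒜 : Γ → AddSubgroup R}

theorem IsLeftModuleGrading.gradedMod {M : Type u} [AddCommGroup M] [Module R M]
    {ℳ : Γ → AddSubgroup M} (h : IsLeftModuleGrading 𝒜 ℳ) : Nonempty (GradedMod 𝒜 ℳ) :=
  let ⟨D⟩ := Decomp.nonempty_iff_isInternal.2 h.isInternal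
  ⟨⟨D, h.smul_mem⟩⟩

theorem GradedMod.isLeftModuleGrading {M : Type u} [AddCommGroup M] [Module R M]
    {ℳ : Γ → AddSubgroup M} (G : GradedMod 𝒜 ℳ) : IsLeftModuleGrading 𝒜 ℳ :=
  ⟨Decomp.nonempty_iff_isInternal.1 ⟨G.toDecomp⟩, G.smul_mem⟩

theorem IsRingGrading.gradedMod (h : IsRingGrading 𝒜) : Nonempty (GradedMod 𝒜 𝒜) :=
  let ⟨D⟩ := Decomp.nonempty_iff_isInternal.2 h.isInternal
  ⟨⟨D, h.mul_mem⟩⟩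

variable (𝒜) in
/-- The grading of the opposite ring by the opposite monoid. -/
def opGrading (γ : Γᵐᵒᵖ) : AddSubgroup Rᵐᵒᵖ := (𝒜 γ.unop).comap opAddEquiv.symm.toAddMonoidHom

/-- The opposite ring is graded by the opposite monoid. -/
def GradedMod.opposite (G : GradedMod 𝒜 𝒜) : GradedMod (opGrading 𝒜) (opGrading 𝒜) where
  toDecomp := G.transport opEquiv opAddEquiv fun _ _ => Iff.rfl
  smul_mem α β a b ha hb := G.smul_mem β.unop α.unop b.unop a.unop hb ha

theorem IsRightModuleGrading.gradedMod {M : Type u} [AddCommGroup M] [Module Rᵐᵒᵖ M]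
    {ℳ : Γ → AddSubgroup M} (h : IsRightModuleGrading 𝒜 ℳ) :
    Nonempty (GradedMod (opGrading 𝒜) fun γ => ℳ γ.unop) :=
  let ⟨D⟩ := Decomp.nonempty_iff_isInternal.2 h.isInternal
  ⟨⟨D.transport opEquiv (AddEquiv.refl M) fun _ _ => Iff.rfl,
    fun α β a m ha hm => h.smul_mem α.unop β.unop a.unop m ha hm⟩⟩

theorem GradedMod.isRightModuleGrading {M : Type u} [AddCommGroup M] [Module Rᵐᵒᵖ M]
    {ℳ : Γᵐᵒᵖ → AddSubgroup M} (G : GradedMod (opGrading 𝒜) ℳ) :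
    IsRightModuleGrading 𝒜 fun γ => ℳ (op γ) :=
  ⟨Decomp.nonempty_iff_isInternal.1
      ⟨G.toDecomp.transport opEquiv.symm (AddEquiv.refl M) fun _ _ => Iff.rfl⟩,
    fun α β a m ha hm => G.smul_mem (op α) (op β) (op a) m ha hm⟩

/-- The right `R`-module `R` is graded. -/
def GradedMod.right (G : GradedMod 𝒜 𝒜) : GradedMod (opGrading 𝒜) fun γ => 𝒜 γ.unop where
  toDecomp := G.transport opEquiv (AddEquiv.refl R) fun _ _ => Iff.rfl
  smul_mem α β a b ha hb := G.smul_mem β.unop α.unop b a.unop hb ha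

theorem flatDim_quotient_le_grLeftWeakDim (G : GradedMod 𝒜 𝒜) {J : Submodule R R}
    (hJ : IsHomogeneousLeftIdeal 𝒜 J) : flatDim R (R ⧸ J) ≤ grLeftWeakDim 𝒜 := by
  obtain ⟨S, hS, rfl⟩ := hJ
  exact le_iSup_of_le (R ⧸ Submodule.span R S) (le_iSup_of_le inferInstance
    (le_iSup_of_le inferInstance (le_iSup_of_le
      ⟨_, (G.quotientSpan G S hS).isLeftModuleGrading⟩ le_rfl)))

theorem flatDim_quotient_le_grRightWeakDim (G : GradedMod 𝒜 𝒜) {I : Submodule Rᵐᵒᵖ R}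
    (hI : IsHomogeneousRightIdeal 𝒜 I) : flatDim Rᵐᵒᵖ (R ⧸ I) ≤ grRightWeakDim 𝒜 := by
  obtain ⟨S, hS, rfl⟩ := hI
  exact le_iSup_of_le (R ⧸ Submodule.span Rᵐᵒᵖ S) (le_iSup_of_le inferInstance
    (le_iSup_of_le inferInstance (le_iSup_of_le
      ⟨_, (G.right.quotientSpan G.opposite S fun s hs =>
        (hS s hs).imp' op fun _ h => h).isRightModuleGrading⟩ le_rfl)))

theorem isRightQuotient_mkQ (S : Set R) :
    IsRightQuotient (RingEquiv.refl Rᵐᵒᵖ) S (Submodule.span Rᵐᵒᵖ S).mkQ.toAddMonoidHom where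
  surjective := Submodule.mkQ_surjective _
  map_mul x a := (Submodule.span Rᵐᵒᵖ S).mkQ.map_smul a x
  map_gen s hs := (Submodule.Quotient.mk_eq_zero _).2 (Submodule.subset_span hs)
  ker_le x hx := by
    have hx' : x ∈ Submodule.span Rᵐᵒᵖ S := (Submodule.Quotient.mk_eq_zero _).1 hx
    refine Submodule.closure_induction (p := fun x _ => x ∈ AddSubgroup.closure _)
      (zero_mem _) (fun _ _ _ _ => add_mem) ?_ hx'
    intro b s hs
    exact AddSubgroup.subset_closure ⟨s, hs, b.unop, rfl⟩

/-- This feeds the criterion over `Rᵐᵒᵖ` with `A = R`: right ideals of `Rᵐᵒᵖ` are left ideals of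
`R`. -/
theorem isRightQuotient_mkQ_unop (S : Set Rᵐᵒᵖ) :
    IsRightQuotient (RingEquiv.opOp R) S
      ((Submodule.span R (op ⁻¹' S)).mkQ.toAddMonoidHom.comp
        opAddEquiv.symm.toAddMonoidHom) where
  surjective := (Submodule.mkQ_surjective _).comp opAddEquiv.symm.surjective
  map_mul x a := (Submodule.span R (op ⁻¹' S)).mkQ.map_smul a x.unop
  map_gen s hs := (Submodule.Quotient.mk_eq_zero _).2 (Submodule.subset_span hs)
  ker_le x hx := by
    have hx' : x.unop ∈ Submodule.span R (op ⁻¹' S) := (Submodule.Quotient.mk_eq_zero _).1 hx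
    refine Submodule.closure_induction (p := fun x _ => op x ∈ AddSubgroup.closure _)
      (zero_mem _) (fun _ _ _ _ => add_mem) ?_ hx'
    intro b s hs
    exact AddSubgroup.subset_closure ⟨op s, hs, op b, rfl⟩

theorem grLeftWeakDim_le (G : GradedMod 𝒜 𝒜) :
    grLeftWeakDim 𝒜 ≤ ⨆ (I : Submodule Rᵐᵒᵖ R) (_ : IsHomogeneousRightIdeal 𝒜 I),
      flatDim Rᵐᵒᵖ (R ⧸ I) := by
  refine iSup_le fun M => iSup_le fun _ => iSup_le fun _ => iSup_le fun ⟨ℳ, hℳ⟩ => ?_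
  obtain ⟨GM⟩ := hℳ.gradedMod
  refine flatDim_le_of_isRightQuotient (RingEquiv.refl Rᵐᵒᵖ) G _ (fun S hS => ?_) GM
  exact ⟨_, _, _, _, isRightQuotient_mkQ S, le_iSup₂_of_le _ ⟨S, hS, rfl⟩ le_rfl⟩

theorem grRightWeakDim_le (G : GradedMod 𝒜 𝒜) :
    grRightWeakDim 𝒜 ≤ ⨆ (J : Submodule R R) (_ : IsHomogeneousLeftIdeal 𝒜 J),
      flatDim R (R ⧸ J) := by
  refine iSup_le fun M => iSup_le fun _ => iSup_le fun _ => iSup_le fun ⟨ℳ, hℳ⟩ => ?_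
  obtain ⟨GM⟩ := hℳ.gradedMod
  refine flatDim_le_of_isRightQuotient (RingEquiv.opOp R) G.opposite _ (fun S hS => ?_) GM
  refine ⟨_, _, _, _, isRightQuotient_mkQ_unop S, le_iSup₂_of_le _ ⟨_, fun s hs => ?_, rfl⟩ le_rfl⟩
  obtain ⟨α, hα⟩ := hS _ hs
  exact ⟨α.unop, hα⟩

end Main

end GradedWD

end

theorem theorem2p8 {Γ : Type v} [CancelMonoid Γ] {R : Type u} [Ring R]
    (𝒜 : Γ → AddSubgroup R) (h𝒜 : GradedWD.IsRingGrading 𝒜) :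
    GradedWD.grLeftWeakDim 𝒜 = GradedWD.grRightWeakDim 𝒜 ∧
    GradedWD.grLeftWeakDim 𝒜 =
      (⨆ (I : Submodule Rᵐᵒᵖ R) (_ : GradedWD.IsHomogeneousRightIdeal 𝒜 I),
        GradedWD.flatDim Rᵐᵒᵖ (R ⧸ I)) ∧
    GradedWD.grLeftWeakDim 𝒜 =
      (⨆ (J : Submodule R R) (_ : GradedWD.IsHomogeneousLeftIdeal 𝒜 J),
        GradedWD.flatDim R (R ⧸ J)) := by
  obtain ⟨G⟩ := h𝒜.gradedMod
  have h₁ := GradedWD.grLeftWeakDim_le G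
  have h₂ : (⨆ (I : Submodule Rᵐᵒᵖ R) (_ : GradedWD.IsHomogeneousRightIdeal 𝒜 I),
      GradedWD.flatDim Rᵐᵒᵖ (R ⧸ I)) ≤ GradedWD.grRightWeakDim 𝒜 :=
    iSup₂_le fun _ hI => GradedWD.flatDim_quotient_le_grRightWeakDim G hI
  have h₃ := GradedWD.grRightWeakDim_le G
  have h₄ : (⨆ (J : Submodule R R) (_ : GradedWD.IsHomogeneousLeftIdeal 𝒜 J),
      GradedWD.flatDim R (R ⧸ J)) ≤ GradedWD.grLeftWeakDim 𝒜 :=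
    iSup₂_le fun _ hJ => GradedWD.flatDim_quotient_le_grLeftWeakDim G hJ
  -- The inequalities `h₁`, `h₂`, `h₃`, `h₄` close a cycle.
  exact ⟨(h₁.trans h₂).antisymm (h₃.trans h₄), h₁.antisymm (h₂.trans (h₃.trans h₄)),
    (h₁.trans (h₂.trans h₃)).antisymm h₄⟩
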